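/- **Setting.** All functions are complex-valued functions of $(x,t)\in\mathbb R^2$ (with $t=t_n$), $D=\partial_x$. Fix an algebra $\mathcal B$ of smooth functions, spaces $\mathcal P,\mathcal Q$ of smooth functions that are $\mathcal B$-modules, and an ideal $\mathcal E$ of $\mathcal B$ with $\mathcal P\cdot\mathcal Q\subseteq\mathcal E$, all stable under $\partial_x,\partial_t$ and such that $D:\mathcal E\to\mathcal E$ is bijective; $D^{-1}\{f\}$ denotes the antiderivative of $f\in\mathcal E$ in $\mathcal E$ (for instance $\int_{-\infty}^x f\,dx'$ for functions decaying exponentially, with all derivatives, as $x\to-\infty$). Integro-differential operators are built from multiplication by matrix functions, $D$, $\partial_t$ and $D^{-1}$; $A\{f\}$ is the action of $A$ on $f$; and ${}^\tau$ is the formal transpose: it reverses products, transposes matrix functions, and $D^\tau=-D$, $\partial_t^\tau=-\partial_t$, $(D^{-1})^\tau=-D^{-1}$. Let $k,l,n\ge 0$ be integers, $\alpha_n,c_l\in\mathbb C$, let $\mathcal J_k,\tilde{\mathcal J}_n$ be constant $N\times N$ matrices and $\mathcal M_0$ a constant $m\times m$ matrix, let $u_j$ $(j<k)$, $v_i$ $(i<n)$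 be $N\times N$ matrix functions over $\mathcal B$, and ${\bf q},{\bf r}$ be $N\times m$ matrix functions over $\mathcal P$ and $\mathcal Q$ respectively. Put $$M_n=\alpha_n\partial_t-\tilde{\mathcal J}_nD^n-\sum_{i=0}^{n-1}v_iD^i-{\bf q}\mathcal M_0D^{-1}{\bf r}^\top,\qquad L_{k,l}=\mathcal J_kD^k+\sum_{j=0}^{k-1}u_jD^j+c_l\sum_{j=0}^{l}{\bf q}[j]\mathcal M_0D^{-1}{\bf r}[l-j]^\top,$$ where ${\bf q}[j]=(M_n)^j\{{\bf q}\}$, ${\bf r}[j]=(M_n^\tau)^j\{{\bf r}\}$, and $\tilde L_{k,l}=L_{k,l}+c_l(M_n)^{l+1}$. Let $\Lambda,\tilde\Lambda,C$ be constant $K\times K$ matrices with $C$ invertible, and let $\varphi,\psi$ be $N\times K$ matrix functions over $\mathcal P$ and $\mathcal Q$ respectively with $$M_n\{\varphi\}=\varphi\Lambda,\quad M_n^\tau\{\psi\}=\psi\tilde\Lambda,\quad L_{k,l}\{\varphi\}=-c_l\varphi\Lambda^{l+1},\quad L_{k,l}^\tau\{\psi\}=-c_l\psi\tilde\Lambda^{l+1}.$$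 Assume that $\Delta=C+D^{-1}\{\psi^\top\varphi\}$ is invertible with $\Delta^{-1}$ over $\mathcal B$, and set $$W=I-\varphi\Delta^{-1}D^{-1}\psi^\top,\qquad W^{-1}=I+\varphi D^{-1}\Delta^{-1}\psi^\top,$$ $\hat M_n=WM_nW^{-1}$, $\hat L_{k,l}=WL_{k,l}W^{-1}$, $\hat{\tilde L}_{k,l}=W\tilde L_{k,l}W^{-1}$. **Claim.** The functions $\Phi=W\{\varphi\}C^{-1}$ and $\Psi=W^{-1,\tau}\{\psi\}(C^{\top})^{-1}$ are equal to $\varphi\Delta^{-1}$ and $\psi(\Delta^{-1})^{\top}$ respectively and satisfy $$\hat{\tilde L}_{k,l}\{\Phi\}=\hat L_{k,l}\{\Phi\}+c_l(\hat M_n)^{l+1}\{\Phi\}=0,\qquad \hat{\tilde L}^\tau_{k,l}\{\Psi\}=\hat L^\tau_{k,l}\{\Psi\}+c_l(\hat M_n^\tau)^{l+1}\{\Psi\}=0.$$ -/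

import Mathlib

open scoped ContDiff

noncomputable section

/-- Complex-valued functions of two real variables `(x, t)`. They form a commutative `ℂ`-algebra
under pointwise operations; `Matrix (Fin a) (Fin b) Fn` is the type of matrix functions. -/
abbrev Fn : Type := ℝ × ℝ → ℂ

/-- The partial derivative in `x` (first variable). -/
def dx (f : Fn) : Fn := fun p => deriv (fun s => f (s, p.2)) p.1

/-- The partial derivative in `t` (second variable). -/
def dt (f : Fn) : Fn := fun p => deriv (fun s => f (p.1, s)) p.2

/-- A constant matrix, regarded as a matrix function. -/
def constMat {a b : ℕ} (A : Matrix (Fin a) (Fin b) ℂ) : Matrix (Fin a) (Fin b) Fn :=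
  A.map (algebraMap ℂ Fn)

/-- The function spaces on which integro-differential operators act: an algebra `B` of smooth
coefficients, a space `P` of functions (on which the operators act), a space `Q` of dual functions
(on which the transposed operators act), and an ideal `E` of `B` that contains all products of
elements of `P` with elements of `Q` and on which `∂/∂x` is bijective, so that `D⁻¹` makes sense
as the two-sided inverse of `D`.

Typical example: all functions smooth, with all their derivatives of the following size as
`x → -∞`, locally uniformly in `t`: bounded for `B`, exponentially decaying for `P = Q = E`;
then `D⁻¹ {f}` is the integral of `f` from `-∞` to `x`. -/
structure FunctionSpaces where
  B : Subalgebra ℂ Fn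
  P : Submodule ℂ Fn
  Q : Submodule ℂ Fn
  E : Submodule ℂ Fn
  smooth_B : ∀ f ∈ B, ContDiff ℝ ∞ f
  smooth_P : ∀ f ∈ P, ContDiff ℝ ∞ f
  smooth_Q : ∀ f ∈ Q, ContDiff ℝ ∞ f
  dx_B : ∀ f ∈ B, dx f ∈ B
  dt_B : ∀ f ∈ B, dt f ∈ B
  dx_P : ∀ f ∈ P, dx f ∈ P
  dt_P : ∀ f ∈ P, dt f ∈ P
  dx_Q : ∀ f ∈ Q, dx f ∈ Q
  dt_Q : ∀ f ∈ Q, dt f ∈ Q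
  dt_E : ∀ f ∈ E, dt f ∈ E
  E_le_B : ∀ f ∈ E, f ∈ B
  mul_P : ∀ b ∈ B, ∀ f ∈ P, b * f ∈ P
  mul_Q : ∀ b ∈ B, ∀ f ∈ Q, b * f ∈ Q
  mul_E : ∀ b ∈ B, ∀ f ∈ E, b * f ∈ E
  mul_P_Q : ∀ f ∈ P, ∀ g ∈ Q, f * g ∈ E
  dx_bijOn : Set.BijOn dx (E : Set Fn) (E : Set Fn)

/-- `D⁻¹ {f}`: the unique antiderivative in `x` of `f` that lies in `E`, for `f` in `E`
(and `0`, by convention, for functions without antiderivative in `E`). -/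
def antider (S : FunctionSpaces) (f : Fn) : Fn :=
  open Classical in
  if h : ∃ g ∈ S.E, dx g = f then h.choose else 0

/-- All entries of the matrix function `h` lie in `V`. -/
def EntriesIn {a b : ℕ} (V : Set Fn) (h : Matrix (Fin a) (Fin b) Fn) : Prop :=
  ∀ i j, h i j ∈ V

/-- Formal integro-differential operators with matrix coefficients, of size `a × b`: the
expressions generated by the operators of multiplication by matrix functions, by `D = ∂/∂x`,
`∂/∂t` and `D⁻¹` under sums, complex multiples and compositions. -/
inductive IDOp : ℕ → ℕ → Type
  | mul {a b : ℕ} (h : Matrix (Fin a) (Fin b) Fn) : IDOp a b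
  | D (a : ℕ) : IDOp a a
  | T (a : ℕ) : IDOp a a
  | Dinv (a : ℕ) : IDOp a a
  | add {a b : ℕ} (A A' : IDOp a b) : IDOp a b
  | smul {a b : ℕ} (c : ℂ) (A : IDOp a b) : IDOp a b
  | comp {a b d : ℕ} (A : IDOp a b) (A' : IDOp b d) : IDOp a d

namespace IDOp

/-- The action `A {f}` of an operator on a matrix function. -/
def act (S : FunctionSpaces) {d : ℕ} : {a b : ℕ} → IDOp a b →
    Matrix (Fin b) (Fin d) Fn → Matrix (Fin a) (Fin d) Fn
  | _, _, mul h, f => h * f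
  | _, _, D _, f => f.map dx
  | _, _, T _, f => f.map dt
  | _, _, Dinv _, f => f.map (antider S)
  | _, _, add A A', f => act S A f + act S A' f
  | _, _, smul c A, f => c • act S A f
  | _, _, comp A A', f => act S A (act S A' f)

/-- The formal transpose `A^τ`: it reverses products, transposes matrix functions and changes the
sign of `D`, `∂/∂t` and `D⁻¹`. -/
def tr : {a b : ℕ} → IDOp a b → IDOp b a
  | _, _, mul h => mul h.transpose
  | _, _, D a => smul (-1) (D a)
  | _, _, T a => smul (-1) (T a)
  | _, _, Dinv a => smul (-1) (Dinv a)
  | _, _, add A A' => add (tr A) (tr A')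
  | _, _, smul c A => smul c (tr A)
  | _, _, comp A A' => comp (tr A') (tr A)

/-- The identity operator. -/
def one (a : ℕ) : IDOp a a := mul 1

/-- The difference of two operators. -/
def sub {a b : ℕ} (A A' : IDOp a b) : IDOp a b := add A (smul (-1) A')

/-- Powers of an operator. -/
def pow {a : ℕ} (A : IDOp a a) : ℕ → IDOp a a
  | 0 => one a
  | j + 1 => comp A (pow A j)

/-- The sum `A 0 + ⋯ + A (d - 1)`. -/
def sum {a b : ℕ} (A : ℕ → IDOp a b) : ℕ → IDOp a b
  | 0 => mul 0
  | d + 1 => add (sum A d) (A d)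

/-- The differential operator `J D^k + ∑_{j < k} u_j D^j`. -/
def diffOp {N : ℕ} (k : ℕ) (J : Matrix (Fin N) (Fin N) ℂ)
    (u : ℕ → Matrix (Fin N) (Fin N) Fn) : IDOp N N :=
  add (comp (mul (constMat J)) (pow (D N) k)) (sum (fun j => comp (mul (u j)) (pow (D N) j)) k)

/-- The integral operator `h A D⁻¹ g^⊤` with a constant matrix `A`. -/
def intOp {N m : ℕ} (h : Matrix (Fin N) (Fin m) Fn) (A : Matrix (Fin m) (Fin m) ℂ)
    (g : Matrix (Fin N) (Fin m) Fn) : IDOp N N :=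
  comp (mul (h * constMat A)) (comp (Dinv m) (mul g.transpose))

/-- The operator `M_n = α ∂_t - J' D^n - ∑_{i < n} v_i D^i - q M₀ D⁻¹ r^⊤`. -/
def opM {N m : ℕ} (n : ℕ) (α : ℂ) (J' : Matrix (Fin N) (Fin N) ℂ)
    (v : ℕ → Matrix (Fin N) (Fin N) Fn) (M₀ : Matrix (Fin m) (Fin m) ℂ)
    (q r : Matrix (Fin N) (Fin m) Fn) : IDOp N N :=
  sub (sub (smul α (T N)) (diffOp n J' v)) (intOp q M₀ r)

/-- The operator `L_{k,l} = J D^k + ∑_{j < k} u_j D^j + c ∑_{j ≤ l} q[j] M₀ D⁻¹ r[l-j]^⊤`, where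
`q[j] = M^j {q}` and `r[j] = (M^τ)^j {r}`. -/
def opL {N m : ℕ} (S : FunctionSpaces) (k l : ℕ) (c : ℂ) (J : Matrix (Fin N) (Fin N) ℂ)
    (u : ℕ → Matrix (Fin N) (Fin N) Fn) (M : IDOp N N) (M₀ : Matrix (Fin m) (Fin m) ℂ)
    (q r : Matrix (Fin N) (Fin m) Fn) : IDOp N N :=
  add (diffOp k J u)
    (smul c (sum (fun j => intOp (act S (pow M j) q) M₀ (act S (pow M.tr (l - j)) r)) (l + 1)))

/-- The operator `L̃ = L + c M^{l+1}`. -/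
def opLtilde {N : ℕ} (l : ℕ) (c : ℂ) (L M : IDOp N N) : IDOp N N :=
  add L (smul c (pow M (l + 1)))

end IDOp

open IDOp in
/-- `Δ = C + D⁻¹ {ψ^⊤ φ}`. -/
def bdtDelta {N K : ℕ} (S : FunctionSpaces) (C : Matrix (Fin K) (Fin K) ℂ)
    (φ ψ : Matrix (Fin N) (Fin K) Fn) : Matrix (Fin K) (Fin K) Fn :=
  constMat C + act S (Dinv K) (ψ.transpose * φ)

open IDOp in
/-- The binary Darboux transformation `W = I - φ Δ⁻¹ D⁻¹ ψ^⊤`. -/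
def bdtW {N K : ℕ} (S : FunctionSpaces) (C : Matrix (Fin K) (Fin K) ℂ)
    (φ ψ : Matrix (Fin N) (Fin K) Fn) : IDOp N N :=
  sub (one N) (comp (mul (φ * (bdtDelta S C φ ψ)⁻¹)) (comp (Dinv K) (mul ψ.transpose)))

open IDOp in
/-- The inverse transformation `W⁻¹ = I + φ D⁻¹ Δ⁻¹ ψ^⊤`. -/
def bdtWinv {N K : ℕ} (S : FunctionSpaces) (C : Matrix (Fin K) (Fin K) ℂ)
    (φ ψ : Matrix (Fin N) (Fin K) Fn) : IDOp N N :=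
  add (one N) (comp (mul φ) (comp (Dinv K) (mul ((bdtDelta S C φ ψ)⁻¹ * ψ.transpose))))

/-- The dressed operator `W A W⁻¹`. -/
def dressed {N K : ℕ} (S : FunctionSpaces) (C : Matrix (Fin K) (Fin K) ℂ)
    (φ ψ : Matrix (Fin N) (Fin K) Fn) (A : IDOp N N) : IDOp N N :=
  (bdtW S C φ ψ).comp (A.comp (bdtWinv S C φ ψ))

end

/-! The whole argument rests on two evaluations. Since `D⁻¹{ψ^⊤φ} = Δ - C`, one gets `W{φ} = φΔ⁻¹C`,
that is, `Φ = φΔ⁻¹` (`bdtW_act`). Since `(Δ⁻¹)_x = -Δ⁻¹ψ^⊤φΔ⁻¹`, the antiderivative in `E` of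
`Δ⁻¹ψ^⊤φΔ⁻¹` is `C⁻¹ - Δ⁻¹`, and hence `W⁻¹{Φ} = φC⁻¹` (`map_antider_inv`, `bdtWinv_act`). The
operator identity `W W⁻¹ = I` is never needed.

All operators involved commute with right multiplication by constant matrices
(`IDOp.IsConstLinear`). So the conjugate of `L` sends `Φ` to `-c Φ C Λ^{l+1} C⁻¹`, while the
conjugate of `M` acts on `Φ` by `CΛC⁻¹` on the right; the two contributions cancel
(`IDOp.conj_act`). The dual statement is the same lemma with `W^{-1,τ}`, `W^τ`, `C^⊤`, `ψ` in place
of `W`, `W⁻¹`, `C`, `φ`.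

As `D⁻¹` is meaningful only on `E`, linearity must be proved together with the spaces preserved: `P`
for the operators, `Q` for their transposes. -/

/-! ### Matrix functions over a function space; constant matrices. -/

lemma EntriesIn.mul {a b d : ℕ} {X V V' : Submodule ℂ Fn}
    {h : Matrix (Fin a) (Fin b) Fn} {f : Matrix (Fin b) (Fin d) Fn}
    (hh : EntriesIn X h) (hf : EntriesIn V f) (hXV : ∀ x ∈ X, ∀ y ∈ V, x * y ∈ V') :
    EntriesIn V' (h * f) := fun i j => by
  rw [Matrix.mul_apply]
  exact V'.sum_mem fun s _ => hXV _ (hh i s) _ (hf s j)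

lemma EntriesIn.add {a b : ℕ} {V : Submodule ℂ Fn} {f g : Matrix (Fin a) (Fin b) Fn}
    (hf : EntriesIn V f) (hg : EntriesIn V g) : EntriesIn V (f + g) :=
  fun i j => V.add_mem (hf i j) (hg i j)

lemma EntriesIn.smul {a b : ℕ} {V : Submodule ℂ Fn} {f : Matrix (Fin a) (Fin b) Fn} (c : ℂ)
    (hf : EntriesIn V f) : EntriesIn V (c • f) :=
  fun i j => V.smul_mem c (hf i j)

lemma EntriesIn.transpose {a b : ℕ} {V : Set Fn} {f : Matrix (Fin a) (Fin b) Fn}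
    (hf : EntriesIn V f) : EntriesIn V f.transpose :=
  fun i j => hf j i

lemma constMat_mul {a b d : ℕ} (A : Matrix (Fin a) (Fin b) ℂ) (A' : Matrix (Fin b) (Fin d) ℂ) :
    constMat (A * A') = constMat A * constMat A' :=
  Matrix.map_mul

lemma constMat_one {a : ℕ} : constMat (1 : Matrix (Fin a) (Fin a) ℂ) = 1 :=
  Matrix.map_one _ (map_zero _) (map_one _)

lemma constMat_transpose {a b : ℕ} (A : Matrix (Fin a) (Fin b) ℂ) :
    constMat A.transpose = (constMat A).transpose := rfl

lemma constMat_smul {a b : ℕ} (c : ℂ) (A : Matrix (Fin a) (Fin b) ℂ) :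
    constMat (c • A) = c • constMat A := by
  ext1 i j
  simp only [constMat, Matrix.map_apply, Matrix.smul_apply, smul_eq_mul, map_mul, Algebra.smul_def]

lemma constMat_inv_mul {a : ℕ} {C : Matrix (Fin a) (Fin a) ℂ} (hC : IsUnit C) :
    constMat C⁻¹ * constMat C = 1 := by
  rw [← constMat_mul, Matrix.nonsing_inv_mul _ ((Matrix.isUnit_iff_isUnit_det _).mp hC),
    constMat_one]

lemma constMat_mul_inv {a : ℕ} {C : Matrix (Fin a) (Fin a) ℂ} (hC : IsUnit C) :
    constMat C * constMat C⁻¹ = 1 :=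
  mul_eq_one_comm.mp (constMat_inv_mul hC)

lemma mul_constMat_apply {a b d : ℕ} (f : Matrix (Fin a) (Fin b) Fn)
    (A : Matrix (Fin b) (Fin d) ℂ) (i : Fin a) (j : Fin d) :
    (f * constMat A) i j = ∑ s, A s j • f i s := by
  rw [Matrix.mul_apply]
  refine Finset.sum_congr rfl fun s _ => ?_
  rw [constMat, Matrix.map_apply, Algebra.smul_def, mul_comm]

lemma EntriesIn.mul_constMat {a b d : ℕ} {V : Submodule ℂ Fn} {f : Matrix (Fin a) (Fin b) Fn}
    (hf : EntriesIn V f) (A : Matrix (Fin b) (Fin d) ℂ) : EntriesIn V (f * constMat A) :=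
  fun i j => by
    rw [mul_constMat_apply]
    exact V.sum_mem fun s _ => V.smul_mem _ (hf i s)

lemma EntriesIn.constMat_mul {a b d : ℕ} {V : Submodule ℂ Fn} {f : Matrix (Fin b) (Fin d) Fn}
    (A : Matrix (Fin a) (Fin b) ℂ) (hf : EntriesIn V f) : EntriesIn V (constMat A * f) :=
  fun i j => by
    rw [Matrix.mul_apply]
    refine V.sum_mem fun s _ => ?_
    rw [constMat, Matrix.map_apply, ← Algebra.smul_def]
    exact V.smul_mem _ (hf s j)

/-- A map that is linear on a space of functions commutes, applied entrywise, with right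
multiplication by constant matrices. -/
lemma map_mul_constMat {a b d : ℕ} {V : Submodule ℂ Fn} {T : Fn → Fn}
    (hadd : ∀ f ∈ V, ∀ g ∈ V, T (f + g) = T f + T g) (hsmul : ∀ (c : ℂ), ∀ f ∈ V, T (c • f) = c • T f)
    {f : Matrix (Fin a) (Fin b) Fn} (hf : EntriesIn V f) (A : Matrix (Fin b) (Fin d) ℂ) :
    (f * constMat A).map T = f.map T * constMat A := by
  -- `T` is linear only on `V`, so it is restricted to `V` before being passed through the finite
  -- sum.
  let T' : V →ₗ[ℂ] Fn :=
    { toFun := fun f => T f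
      map_add' := fun f g => hadd f f.2 g g.2
      map_smul' := fun c f => hsmul c f f.2 }
  ext1 i j
  have h := map_sum T' (fun s => A s j • (⟨f i s, hf i s⟩ : V)) Finset.univ
  simp only [map_smul] at h
  rw [Matrix.map_apply, mul_constMat_apply, mul_constMat_apply]
  refine Eq.trans ?_ h
  change T _ = T _
  congr 1
  simp

/-! ### Rules for the partial derivatives. -/

lemma hasDerivAt_dx {f : Fn} (hf : ContDiff ℝ ∞ f) (p : ℝ × ℝ) :
    HasDerivAt (fun s => f (s, p.2)) (dx f p) p.1 := by
  have h : Differentiable ℝ fun s : ℝ => f (s, p.2) :=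
    (hf.differentiable (by simp)).comp (by fun_prop)
  exact (h p.1).hasDerivAt

lemma hasDerivAt_dt {f : Fn} (hf : ContDiff ℝ ∞ f) (p : ℝ × ℝ) :
    HasDerivAt (fun s => f (p.1, s)) (dt f p) p.2 := by
  have h : Differentiable ℝ fun s : ℝ => f (p.1, s) :=
    (hf.differentiable (by simp)).comp (by fun_prop)
  exact (h p.2).hasDerivAt

lemma dx_add {f g : Fn} (hf : ContDiff ℝ ∞ f) (hg : ContDiff ℝ ∞ g) :
    dx (f + g) = dx f + dx g :=
  funext fun p => ((hasDerivAt_dx hf p).add (hasDerivAt_dx hg p)).deriv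

lemma dt_add {f g : Fn} (hf : ContDiff ℝ ∞ f) (hg : ContDiff ℝ ∞ g) :
    dt (f + g) = dt f + dt g :=
  funext fun p => ((hasDerivAt_dt hf p).add (hasDerivAt_dt hg p)).deriv

lemma dx_smul (c : ℂ) {f : Fn} (hf : ContDiff ℝ ∞ f) : dx (c • f) = c • dx f :=
  funext fun p => ((hasDerivAt_dx hf p).const_smul c).deriv

lemma dt_smul (c : ℂ) {f : Fn} (hf : ContDiff ℝ ∞ f) : dt (c • f) = c • dt f :=
  funext fun p => ((hasDerivAt_dt hf p).const_smul c).deriv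

lemma dx_algebraMap (c : ℂ) : dx (algebraMap ℂ Fn c) = 0 :=
  funext fun _ => deriv_const _ c

lemma map_dx_constMat {a b : ℕ} (A : Matrix (Fin a) (Fin b) ℂ) : (constMat A).map dx = 0 := by
  ext1 i j
  exact dx_algebraMap (A i j)

lemma map_dx_add {a b : ℕ} {f g : Matrix (Fin a) (Fin b) Fn}
    (hf : ∀ i j, ContDiff ℝ ∞ (f i j)) (hg : ∀ i j, ContDiff ℝ ∞ (g i j)) :
    (f + g).map dx = f.map dx + g.map dx := by
  ext1 i j
  exact dx_add (hf i j) (hg i j)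

lemma map_dx_mul {a b d : ℕ} {f : Matrix (Fin a) (Fin b) Fn} {g : Matrix (Fin b) (Fin d) Fn}
    (hf : ∀ i j, ContDiff ℝ ∞ (f i j)) (hg : ∀ i j, ContDiff ℝ ∞ (g i j)) :
    (f * g).map dx = f.map dx * g + f * g.map dx := by
  ext i j p
  have h : HasDerivAt (fun s => ∑ y, f i y (s, p.2) * g y j (s, p.2))
      (∑ y, (dx (f i y) p * g y j p + f i y p * dx (g y j) p)) p.1 :=
    HasDerivAt.fun_sum fun y _ => (hasDerivAt_dx (hf i y) p).mul (hasDerivAt_dx (hg y j) p)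
  have h' := h.deriv
  simp only [Matrix.map_apply, Matrix.add_apply, Matrix.mul_apply, Pi.add_apply, Finset.sum_apply,
    Pi.mul_apply, dx]
  simpa only [Finset.sum_add_distrib, dx] using h'

/-! ### The antiderivative on `E`. -/

namespace FunctionSpaces

/-- Injectivity of `D` on `E` makes the choice in `antider` irrelevant; every value of `D⁻¹` below
is found by exhibiting a candidate in `E`. -/
lemma antider_eq (S : FunctionSpaces) {f g : Fn} (hg : g ∈ S.E) (h : dx g = f) :
    antider S f = g := by
  have hex : ∃ g ∈ S.E, dx g = f := ⟨g, hg, h⟩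
  rw [antider, dif_pos hex]
  exact S.dx_bijOn.injOn hex.choose_spec.1 hg (hex.choose_spec.2.trans h.symm)

lemma antider_spec (S : FunctionSpaces) {f : Fn} (hf : f ∈ S.E) :
    antider S f ∈ S.E ∧ dx (antider S f) = f := by
  obtain ⟨g, hg, h⟩ := S.dx_bijOn.surjOn hf
  rw [S.antider_eq hg h]
  exact ⟨hg, h⟩

lemma smooth_E (S : FunctionSpaces) : ∀ f ∈ S.E, ContDiff ℝ ∞ f :=
  fun f hf => S.smooth_B f (S.E_le_B f hf)

lemma antider_add (S : FunctionSpaces) {f g : Fn} (hf : f ∈ S.E) (hg : g ∈ S.E) :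
    antider S (f + g) = antider S f + antider S g := by
  obtain ⟨hf, hf'⟩ := S.antider_spec hf
  obtain ⟨hg, hg'⟩ := S.antider_spec hg
  refine S.antider_eq (S.E.add_mem hf hg) ?_
  rw [dx_add (S.smooth_E _ hf) (S.smooth_E _ hg), hf', hg']

lemma antider_smul (S : FunctionSpaces) (c : ℂ) {f : Fn} (hf : f ∈ S.E) :
    antider S (c • f) = c • antider S f := by
  obtain ⟨hf, hf'⟩ := S.antider_spec hf
  refine S.antider_eq (S.E.smul_mem c hf) ?_
  rw [dx_smul c (S.smooth_E _ hf), hf']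

/-- A space of smooth functions that is a module over the coefficients and stable under the
partial derivatives. -/
structure IsDModule (S : FunctionSpaces) (V : Submodule ℂ Fn) : Prop where
  smooth : ∀ f ∈ V, ContDiff ℝ ∞ f
  dx_mem : ∀ f ∈ V, dx f ∈ V
  dt_mem : ∀ f ∈ V, dt f ∈ V
  mul_mem : ∀ b ∈ S.B, ∀ f ∈ V, b * f ∈ V

lemma isDModule_P (S : FunctionSpaces) : S.IsDModule S.P := ⟨S.smooth_P, S.dx_P, S.dt_P, S.mul_P⟩

lemma isDModule_Q (S : FunctionSpaces) : S.IsDModule S.Q := ⟨S.smooth_Q, S.dx_Q, S.dt_Q, S.mul_Q⟩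

lemma mul_Q_P (S : FunctionSpaces) : ∀ f ∈ S.Q, ∀ g ∈ S.P, f * g ∈ S.E :=
  fun f hf g hg => mul_comm g f ▸ S.mul_P_Q g hg f hf

lemma constMat_mem (S : FunctionSpaces) {a b : ℕ} (A : Matrix (Fin a) (Fin b) ℂ) :
    EntriesIn S.B (constMat A) :=
  fun i j => S.B.algebraMap_mem (A i j)

end FunctionSpaces

/-! ### Stability and linearity of the operators over constant matrices. -/

namespace IDOp

/-- The operator `A` maps matrix functions over `V` to matrix functions over `V'`, and commutes on
them with right multiplication by constant matrices. -/
structure IsConstLinear (S : FunctionSpaces) {a b : ℕ} (A : IDOp a b) (V V' : Submodule ℂ Fn) :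
    Prop where
  mem : ∀ {d : ℕ} {f : Matrix (Fin b) (Fin d) Fn}, EntriesIn V f → EntriesIn V' (A.act S f)
  act_mul : ∀ {d e : ℕ} {f : Matrix (Fin b) (Fin d) Fn}, EntriesIn V f →
    ∀ Z : Matrix (Fin d) (Fin e) ℂ, A.act S (f * constMat Z) = A.act S f * constMat Z

namespace IsConstLinear

variable {S : FunctionSpaces} {V V' V'' : Submodule ℂ Fn} {a b d : ℕ}

lemma act_smul {A : IDOp a b} (hA : A.IsConstLinear S V V') {f : Matrix (Fin b) (Fin d) Fn}
    (hf : EntriesIn V f) (c : ℂ) : A.act S (c • f) = c • A.act S f := by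
  have h := hA.act_mul hf (c • (1 : Matrix (Fin d) (Fin d) ℂ))
  simpa only [constMat_smul, constMat_one, Matrix.mul_smul, Matrix.mul_one] using h

lemma mul {X : Submodule ℂ Fn} {h : Matrix (Fin a) (Fin b) Fn} (hh : EntriesIn X h)
    (hX : ∀ x ∈ X, ∀ f ∈ V, x * f ∈ V') : (IDOp.mul h).IsConstLinear S V V' where
  mem hf := hh.mul hf hX
  act_mul _ _ := (Matrix.mul_assoc _ _ _).symm

lemma comp {A : IDOp a b} {A' : IDOp b d} (hA : A.IsConstLinear S V' V'')
    (hA' : A'.IsConstLinear S V V') : (A.comp A').IsConstLinear S V V'' where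
  mem hf := hA.mem (hA'.mem hf)
  act_mul hf Z := by
    simp only [act]
    rw [hA'.act_mul hf, hA.act_mul (hA'.mem hf)]

lemma add {A A' : IDOp a b} (hA : A.IsConstLinear S V V') (hA' : A'.IsConstLinear S V V') :
    (A.add A').IsConstLinear S V V' where
  mem hf := (hA.mem hf).add (hA'.mem hf)
  act_mul hf Z := by
    simp only [act]
    rw [hA.act_mul hf, hA'.act_mul hf, Matrix.add_mul]

lemma smul (c : ℂ) {A : IDOp a b} (hA : A.IsConstLinear S V V') :
    (A.smul c).IsConstLinear S V V' where
  mem hf := (hA.mem hf).smul c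
  act_mul hf Z := by
    simp only [act]
    rw [hA.act_mul hf, Matrix.smul_mul]

lemma sub {A A' : IDOp a b} (hA : A.IsConstLinear S V V') (hA' : A'.IsConstLinear S V V') :
    (A.sub A').IsConstLinear S V V' :=
  hA.add (hA'.smul _)

lemma one : (IDOp.one a).IsConstLinear S V V where
  mem hf := by simpa only [IDOp.one, act, Matrix.one_mul] using hf
  act_mul _ _ := by simp only [IDOp.one, act, Matrix.one_mul]

lemma mul_zero : (IDOp.mul (0 : Matrix (Fin a) (Fin b) Fn)).IsConstLinear S V V' where
  mem _ := by
    simp only [act, Matrix.zero_mul]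
    exact fun _ _ => V'.zero_mem
  act_mul _ _ := by simp only [act, Matrix.zero_mul]

lemma pow {A : IDOp a a} (hA : A.IsConstLinear S V V) : ∀ j, (A.pow j).IsConstLinear S V V
  | 0 => one
  | j + 1 => hA.comp (pow hA j)

lemma tr_pow {A : IDOp a a} (hA : A.tr.IsConstLinear S V V) :
    ∀ j, (A.pow j).tr.IsConstLinear S V V
  | 0 => by simpa only [IDOp.pow, IDOp.one, tr, Matrix.transpose_one] using one
  | j + 1 => (tr_pow hA j).comp hA

lemma sum {A : ℕ → IDOp a b} : ∀ e, (∀ j < e, (A j).IsConstLinear S V V') →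
    (IDOp.sum A e).IsConstLinear S V V'
  | 0, _ => mul_zero
  | e + 1, hA => (sum e fun j hj => hA j (by omega)).add (hA e (by omega))

lemma tr_sum {A : ℕ → IDOp a b} : ∀ e, (∀ j < e, (A j).tr.IsConstLinear S V V') →
    (IDOp.sum A e).tr.IsConstLinear S V V'
  | 0, _ => by simpa only [IDOp.sum, tr, Matrix.transpose_zero] using mul_zero
  | e + 1, hA => (tr_sum e fun j hj => hA j (by omega)).add (hA e (by omega))

lemma D (hV : S.IsDModule V) : (IDOp.D a).IsConstLinear S V V where
  mem hf i j := hV.dx_mem _ (hf i j)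
  act_mul hf Z := map_mul_constMat
    (fun f hf g hg => dx_add (hV.smooth f hf) (hV.smooth g hg))
    (fun c f hf => dx_smul c (hV.smooth f hf)) hf Z

lemma T (hV : S.IsDModule V) : (IDOp.T a).IsConstLinear S V V where
  mem hf i j := hV.dt_mem _ (hf i j)
  act_mul hf Z := map_mul_constMat
    (fun f hf g hg => dt_add (hV.smooth f hf) (hV.smooth g hg))
    (fun c f hf => dt_smul c (hV.smooth f hf)) hf Z

lemma Dinv : (IDOp.Dinv a).IsConstLinear S S.E S.E where
  mem hf i j := (S.antider_spec (hf i j)).1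
  act_mul hf Z := map_mul_constMat
    (fun _ hf _ hg => S.antider_add hf hg) (fun c _ hf => S.antider_smul c hf) hf Z

lemma mul_coeff (hV : S.IsDModule V) {h : Matrix (Fin a) (Fin b) Fn} (hh : EntriesIn S.B h) :
    (IDOp.mul h).IsConstLinear S V V :=
  mul (X := Subalgebra.toSubmodule S.B) hh hV.mul_mem

/-- This absorbs the output of `D⁻¹`: it lies in `E ⊆ B`, and `V` is a `B`-module. -/
lemma mul_of_E (hV : S.IsDModule V) {h : Matrix (Fin a) (Fin b) Fn} (hh : EntriesIn V h) :
    (IDOp.mul h).IsConstLinear S S.E V :=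
  mul hh fun x hx f hf => mul_comm f x ▸ hV.mul_mem f (S.E_le_B f hf) x hx

lemma integral (hV : S.IsDModule V) (hE : ∀ f ∈ V', ∀ g ∈ V, f * g ∈ S.E)
    {h : Matrix (Fin a) (Fin b) Fn} {g : Matrix (Fin b) (Fin d) Fn}
    (hh : EntriesIn V h) (hg : EntriesIn V' g) :
    ((IDOp.mul h).comp ((IDOp.Dinv b).comp (IDOp.mul g))).IsConstLinear S V V :=
  (mul_of_E hV hh).comp (Dinv.comp (mul hg hE))

/-- The transpose of `h D⁻¹ g` is `-g^⊤ D⁻¹ h^⊤`, so the spaces of the two factors trade places. -/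
lemma tr_integral (hV : S.IsDModule V) (hE : ∀ f ∈ V', ∀ g ∈ V, f * g ∈ S.E)
    {h : Matrix (Fin a) (Fin b) Fn} {g : Matrix (Fin b) (Fin d) Fn}
    (hh : EntriesIn V' h) (hg : EntriesIn V g) :
    ((IDOp.mul h).comp ((IDOp.Dinv b).comp (IDOp.mul g))).tr.IsConstLinear S V V :=
  ((mul_of_E hV hg.transpose).comp (Dinv.smul _)).comp (mul hh.transpose hE)

variable {N m K : ℕ}

lemma diffOp (hV : S.IsDModule V) (k : ℕ) (J : Matrix (Fin N) (Fin N) ℂ)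
    {u : ℕ → Matrix (Fin N) (Fin N) Fn} (hu : ∀ j < k, EntriesIn S.B (u j)) :
    (IDOp.diffOp k J u).IsConstLinear S V V :=
  ((mul_coeff hV (S.constMat_mem J)).comp ((D hV).pow k)).add
    (sum k fun j hj => (mul_coeff hV (hu j hj)).comp ((D hV).pow j))

lemma tr_diffOp (hV : S.IsDModule V) (k : ℕ) (J : Matrix (Fin N) (Fin N) ℂ)
    {u : ℕ → Matrix (Fin N) (Fin N) Fn} (hu : ∀ j < k, EntriesIn S.B (u j)) :
    (IDOp.diffOp k J u).tr.IsConstLinear S V V :=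
  have hD : (IDOp.D N).tr.IsConstLinear S V V := (D hV).smul _
  ((hD.tr_pow k).comp (mul_coeff hV (S.constMat_mem J).transpose)).add
    (tr_sum k fun j hj => (hD.tr_pow j).comp (mul_coeff hV (hu j hj).transpose))

variable {q r : Matrix (Fin N) (Fin m) Fn} {M₀ : Matrix (Fin m) (Fin m) ℂ}

lemma intOp (hq : EntriesIn S.P q) (hr : EntriesIn S.Q r) :
    (IDOp.intOp q M₀ r).IsConstLinear S S.P S.P :=
  integral S.isDModule_P S.mul_Q_P (hq.mul_constMat M₀) hr.transpose

lemma tr_intOp (hq : EntriesIn S.P q) (hr : EntriesIn S.Q r) :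
    (IDOp.intOp q M₀ r).tr.IsConstLinear S S.Q S.Q :=
  tr_integral S.isDModule_Q S.mul_P_Q (hq.mul_constMat M₀) hr.transpose

variable {n : ℕ} {α : ℂ} {J' : Matrix (Fin N) (Fin N) ℂ} {v : ℕ → Matrix (Fin N) (Fin N) Fn}

lemma opM (hv : ∀ i < n, EntriesIn S.B (v i)) (hq : EntriesIn S.P q) (hr : EntriesIn S.Q r) :
    (IDOp.opM n α J' v M₀ q r).IsConstLinear S S.P S.P :=
  (((T S.isDModule_P).smul α).sub (diffOp S.isDModule_P n J' hv)).sub (intOp hq hr)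

lemma tr_opM (hv : ∀ i < n, EntriesIn S.B (v i)) (hq : EntriesIn S.P q)
    (hr : EntriesIn S.Q r) : (IDOp.opM n α J' v M₀ q r).tr.IsConstLinear S S.Q S.Q :=
  ((((T S.isDModule_Q).smul _).smul α).add ((tr_diffOp S.isDModule_Q n J' hv).smul _)).add
    ((tr_intOp hq hr).smul _)

variable {k l : ℕ} {c : ℂ} {J : Matrix (Fin N) (Fin N) ℂ} {u : ℕ → Matrix (Fin N) (Fin N) Fn}
  {M : IDOp N N}

/-- The functions `q[j]` and `r[l-j]` stay over `P` and `Q` because `M` and `M^τ` preserve these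
spaces. -/
lemma opL (hu : ∀ j < k, EntriesIn S.B (u j)) (hM : M.IsConstLinear S S.P S.P)
    (hM' : M.tr.IsConstLinear S S.Q S.Q) (hq : EntriesIn S.P q) (hr : EntriesIn S.Q r) :
    (IDOp.opL S k l c J u M M₀ q r).IsConstLinear S S.P S.P :=
  (diffOp S.isDModule_P k J hu).add
    ((sum _ fun j _ => intOp ((hM.pow j).mem hq) ((hM'.pow (l - j)).mem hr)).smul c)

lemma tr_opL (hu : ∀ j < k, EntriesIn S.B (u j)) (hM : M.IsConstLinear S S.P S.P)
    (hM' : M.tr.IsConstLinear S S.Q S.Q) (hq : EntriesIn S.P q) (hr : EntriesIn S.Q r) :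
    (IDOp.opL S k l c J u M M₀ q r).tr.IsConstLinear S S.Q S.Q :=
  (tr_diffOp S.isDModule_Q k J hu).add
    ((tr_sum _ fun j _ => tr_intOp ((hM.pow j).mem hq) ((hM'.pow (l - j)).mem hr)).smul c)

variable {C : Matrix (Fin K) (Fin K) ℂ} {φ ψ : Matrix (Fin N) (Fin K) Fn}

lemma bdtW (hφ : EntriesIn S.P φ) (hψ : EntriesIn S.Q ψ)
    (hΔ : EntriesIn S.B (bdtDelta S C φ ψ)⁻¹) : (bdtW S C φ ψ).IsConstLinear S S.P S.P :=
  one.sub (integral S.isDModule_P S.mul_Q_P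
    (hφ.mul (V := Subalgebra.toSubmodule S.B) hΔ
      fun x hx y hy => mul_comm y x ▸ S.mul_P y hy x hx) hψ.transpose)

lemma bdtWinv (hφ : EntriesIn S.P φ) (hψ : EntriesIn S.Q ψ)
    (hΔ : EntriesIn S.B (bdtDelta S C φ ψ)⁻¹) : (bdtWinv S C φ ψ).IsConstLinear S S.P S.P :=
  one.add (integral S.isDModule_P S.mul_Q_P hφ
    (EntriesIn.mul (X := Subalgebra.toSubmodule S.B) hΔ hψ.transpose S.mul_Q))

lemma tr_one : (IDOp.one a).tr.IsConstLinear S V V := by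
  simpa only [IDOp.one, tr, Matrix.transpose_one] using one

lemma tr_bdtW (hφ : EntriesIn S.P φ) (hψ : EntriesIn S.Q ψ)
    (hΔ : EntriesIn S.B (_root_.bdtDelta S C φ ψ)⁻¹) :
    (_root_.bdtW S C φ ψ).tr.IsConstLinear S S.Q S.Q :=
  tr_one.add ((tr_integral S.isDModule_Q S.mul_P_Q
    (hφ.mul (V := Subalgebra.toSubmodule S.B) hΔ
      fun x hx y hy => mul_comm y x ▸ S.mul_P y hy x hx) hψ.transpose).smul _)

lemma tr_bdtWinv (hφ : EntriesIn S.P φ) (hψ : EntriesIn S.Q ψ)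
    (hΔ : EntriesIn S.B (_root_.bdtDelta S C φ ψ)⁻¹) :
    (_root_.bdtWinv S C φ ψ).tr.IsConstLinear S S.Q S.Q :=
  tr_one.add (tr_integral S.isDModule_Q S.mul_P_Q hφ
    (EntriesIn.mul (X := Subalgebra.toSubmodule S.B) hΔ hψ.transpose S.mul_Q))

end IsConstLinear

/-! ### Powers and conjugation on eigenfunctions. -/

variable {S : FunctionSpaces} {V : Submodule ℂ Fn} {N K : ℕ}

lemma act_pow_of_act_eq {A : IDOp N N} (hA : A.IsConstLinear S V V)
    {f : Matrix (Fin N) (Fin K) Fn} (hf : EntriesIn V f) {X : Matrix (Fin K) (Fin K) ℂ}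
    (h : A.act S f = f * constMat X) (j : ℕ) : (A.pow j).act S f = f * constMat (X ^ j) := by
  induction j with
  | zero => simp [pow, one, act, constMat_one]
  | succ j ih =>
    simp only [pow, act]
    rw [ih, hA.act_mul hf, h, Matrix.mul_assoc, ← constMat_mul, pow_succ']

/-- Operators are formal expressions and transposition reverses the order in which a power is
composed, so the two sides agree only as actions. -/
lemma act_tr_pow {d : ℕ} (A : IDOp N N) (j : ℕ) (f : Matrix (Fin N) (Fin d) Fn) :
    (A.pow j).tr.act S f = (A.tr.pow j).act S f := by
  induction j generalizing f with
  | zero => simp [pow, one, tr, act]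
  | succ j ih =>
    have hcomm : ∀ (i : ℕ) (g : Matrix (Fin N) (Fin d) Fn),
        (A.tr.pow i).act S (A.tr.act S g) = A.tr.act S ((A.tr.pow i).act S g) := by
      intro i
      induction i with
      | zero => simp [pow, one, act]
      | succ i ih' => exact fun g => congrArg (A.tr.act S) (ih' g)
    simp only [pow, tr, act]
    rw [ih, hcomm]

/-- Eigenfunction relations for `M` and `L` on `φ` are transferred to the operators conjugated by
`W`, where `W` and `W'` exchange `φ` and `Φ` up to constant matrices. -/
lemma conj_act {W M L W' : IDOp N N} (hW : W.IsConstLinear S V V) (hM : M.IsConstLinear S V V)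
    (hL : L.IsConstLinear S V V) (hW' : W'.IsConstLinear S V V)
    {φ Φ : Matrix (Fin N) (Fin K) Fn} (hφ : EntriesIn V φ) {Y Y' X : Matrix (Fin K) (Fin K) ℂ}
    (hY : Y * Y' = 1) (hWφ : W.act S φ = Φ * constMat Y) (hWΦ : W'.act S Φ = φ * constMat Y')
    (hMφ : M.act S φ = φ * constMat X) {l : ℕ} {c : ℂ}
    (hLφ : L.act S φ = -c • (φ * constMat (X ^ (l + 1)))) :
    W.act S ((L.act S (W'.act S Φ)) + c • (M.pow (l + 1)).act S (W'.act S Φ)) = 0 ∧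
    W.act S (L.act S (W'.act S Φ)) +
      c • ((W.comp (M.comp W')).pow (l + 1)).act S Φ = 0 := by
  have hY' : Y' * Y = 1 := mul_eq_one_comm.mp hY
  have hΦ' : Φ = W.act S φ * constMat Y' := by
    rw [hWφ, Matrix.mul_assoc, ← constMat_mul, hY, constMat_one, Matrix.mul_one]
  have hΦ : EntriesIn V Φ := by
    rw [hΦ']
    exact (hW.mem hφ).mul_constMat Y'
  have hφZ (Z : Matrix (Fin K) (Fin K) ℂ) : EntriesIn V (φ * constMat Z) := hφ.mul_constMat Z
  have hLΦ : L.act S (W'.act S Φ) = -c • (φ * constMat (X ^ (l + 1) * Y')) := by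
    rw [hWΦ, hL.act_mul hφ, hLφ, Matrix.smul_mul, Matrix.mul_assoc, ← constMat_mul]
  have hMΦ : (M.pow (l + 1)).act S (W'.act S Φ) = φ * constMat (X ^ (l + 1) * Y') := by
    rw [hWΦ, (hM.pow _).act_mul hφ, act_pow_of_act_eq hM hφ hMφ, Matrix.mul_assoc, ← constMat_mul]
  constructor
  -- The argument of `W` cancels to zero; homogeneity with the scalar `0` gives `W{0} = 0`.
  · have h0 := hW.act_smul hφ 0
    rw [zero_smul, zero_smul] at h0
    rw [hLΦ, hMΦ, neg_smul, neg_add_cancel, h0]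
  -- `Φ` is an eigenfunction of the conjugated `M`, with spectral matrix conjugated by `Y`.
  · have hhat : (W.comp (M.comp W')).act S Φ = Φ * constMat (Y * X * Y') := by
      simp only [act]
      rw [hWΦ, hM.act_mul hφ, hMφ, Matrix.mul_assoc, ← constMat_mul, hW.act_mul hφ, hWφ,
        Matrix.mul_assoc, ← constMat_mul, Matrix.mul_assoc]
    have hpow : ∀ j, (Y * X * Y') ^ j = Y * X ^ j * Y' := by
      intro j
      induction j with
      | zero => simp [hY]
      | succ j ih =>
        rw [pow_succ, ih, pow_succ]
        calc Y * X ^ j * Y' * (Y * X * Y') = Y * X ^ j * (Y' * Y) * X * Y' := by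
              simp only [Matrix.mul_assoc]
          _ = Y * (X ^ j * X) * Y' := by simp only [hY', Matrix.mul_one, Matrix.mul_assoc]
    rw [act_pow_of_act_eq (hW.comp (hM.comp hW')) hΦ hhat, hpow, hLΦ, hW.act_smul (hφZ _),
      hW.act_mul hφ, hWφ, Matrix.mul_assoc, ← constMat_mul, Matrix.mul_assoc, neg_smul,
      neg_add_cancel]

end IDOp

/-! ### The matrix `Δ` and the action of the Darboux transformation. -/

namespace FunctionSpaces

variable {N K : ℕ} {S : FunctionSpaces} {C : Matrix (Fin K) (Fin K) ℂ}
  {φ ψ : Matrix (Fin N) (Fin K) Fn}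

lemma map_antider_eq (S : FunctionSpaces) {a b : ℕ} {f g : Matrix (Fin a) (Fin b) Fn}
    (hg : EntriesIn S.E g) (h : g.map dx = f) : f.map (antider S) = g := by
  ext1 i j
  exact S.antider_eq (hg i j) (congrFun₂ h i j)

lemma map_antider_mem (hφ : EntriesIn S.P φ) (hψ : EntriesIn S.Q ψ) :
    EntriesIn S.E ((ψ.transpose * φ).map (antider S)) :=
  fun i j => (S.antider_spec ((hψ.transpose.mul hφ S.mul_Q_P) i j)).1

lemma map_antider_eq_sub : (ψ.transpose * φ).map (antider S) = bdtDelta S C φ ψ - constMat C :=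
  (add_sub_cancel_left _ _).symm

lemma bdtDelta_smooth (hφ : EntriesIn S.P φ) (hψ : EntriesIn S.Q ψ) (i j : Fin K) :
    ContDiff ℝ ∞ (bdtDelta S C φ ψ i j) :=
  (S.smooth_B _ (S.constMat_mem C i j)).add (S.smooth_E _ (map_antider_mem hφ hψ i j))

lemma map_dx_bdtDelta (hφ : EntriesIn S.P φ) (hψ : EntriesIn S.Q ψ) :
    (bdtDelta S C φ ψ).map dx = ψ.transpose * φ := by
  have h : bdtDelta S C φ ψ = constMat C + (ψ.transpose * φ).map (antider S) := rfl
  rw [h, map_dx_add (fun i j => S.smooth_B _ (S.constMat_mem C i j))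
    (fun i j => S.smooth_E _ (map_antider_mem hφ hψ i j)), map_dx_constMat, zero_add]
  ext1 i j
  exact (S.antider_spec ((hψ.transpose.mul hφ S.mul_Q_P) i j)).2

lemma bdtDelta_inv_mul (hΔ : IsUnit (bdtDelta S C φ ψ)) :
    (bdtDelta S C φ ψ)⁻¹ * bdtDelta S C φ ψ = 1 :=
  Matrix.nonsing_inv_mul _ ((Matrix.isUnit_iff_isUnit_det _).mp hΔ)

/-- Differentiate `Δ⁻¹Δ = 1`, using `Δ_x = ψ^⊤φ`. -/
lemma map_dx_bdtDelta_inv (hφ : EntriesIn S.P φ) (hψ : EntriesIn S.Q ψ)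
    (hΔ : IsUnit (bdtDelta S C φ ψ)) (hΔB : EntriesIn S.B (bdtDelta S C φ ψ)⁻¹) :
    (bdtDelta S C φ ψ)⁻¹.map dx =
      -((bdtDelta S C φ ψ)⁻¹ * (ψ.transpose * φ) * (bdtDelta S C φ ψ)⁻¹) := by
  have h1 := bdtDelta_inv_mul hΔ
  have h2 := mul_eq_one_comm.mp h1
  have h := map_dx_mul (fun i j => S.smooth_B _ (hΔB i j)) (bdtDelta_smooth (C := C) hφ hψ)
  rw [h1, map_dx_bdtDelta hφ hψ, ← constMat_one, map_dx_constMat] at h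
  have h' := congrArg (· * (bdtDelta S C φ ψ)⁻¹) h
  simp only [Matrix.zero_mul, Matrix.add_mul, Matrix.mul_assoc, h2, Matrix.mul_one] at h'
  simpa only [Matrix.mul_assoc] using eq_neg_of_add_eq_zero_left h'.symm

/-- The antiderivative of `Δ⁻¹ ψ^⊤ φ Δ⁻¹` is `C⁻¹ - Δ⁻¹`. -/
lemma map_antider_inv (hC : IsUnit C) (hφ : EntriesIn S.P φ) (hψ : EntriesIn S.Q ψ)
    (hΔ : IsUnit (bdtDelta S C φ ψ)) (hΔB : EntriesIn S.B (bdtDelta S C φ ψ)⁻¹) :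
    ((bdtDelta S C φ ψ)⁻¹ * (ψ.transpose * φ) * (bdtDelta S C φ ψ)⁻¹).map (antider S) =
      constMat C⁻¹ - (bdtDelta S C φ ψ)⁻¹ := by
  have h2 := mul_eq_one_comm.mp (bdtDelta_inv_mul hΔ)
  apply S.map_antider_eq
  -- The constant of integration is `C⁻¹` because `C⁻¹ - Δ⁻¹ = C⁻¹(Δ - C)Δ⁻¹`, which lies in the
  -- ideal `E` along with `Δ - C`.
  · have h : constMat C⁻¹ - (bdtDelta S C φ ψ)⁻¹ =
        constMat C⁻¹ * ((ψ.transpose * φ).map (antider S) * (bdtDelta S C φ ψ)⁻¹) := by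
      rw [map_antider_eq_sub (C := C), Matrix.sub_mul, h2, Matrix.mul_sub, Matrix.mul_one,
        ← Matrix.mul_assoc, constMat_inv_mul hC, Matrix.one_mul]
    rw [h]
    exact EntriesIn.constMat_mul _ ((map_antider_mem hφ hψ).mul
      (V := Subalgebra.toSubmodule S.B) hΔB fun x hx y hy => mul_comm y x ▸ S.mul_E y hy x hx)
  -- The minus sign becomes a constant matrix factor, so that linearity of `∂_x` over constant
  -- matrices applies.
  · have hneg : constMat C⁻¹ - (bdtDelta S C φ ψ)⁻¹ =
        constMat C⁻¹ + (bdtDelta S C φ ψ)⁻¹ * constMat (-1) := by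
      rw [← neg_one_smul ℂ (1 : Matrix (Fin K) (Fin K) ℂ), constMat_smul, constMat_one,
        Matrix.mul_smul, Matrix.mul_one, neg_one_smul, sub_eq_add_neg]
    rw [hneg, map_dx_add (fun i j => S.smooth_B _ (S.constMat_mem C⁻¹ i j))
      (fun i j => S.smooth_B _ (EntriesIn.mul_constMat
        (V := Subalgebra.toSubmodule S.B) hΔB _ i j)),
      map_mul_constMat (V := Subalgebra.toSubmodule S.B)
        (fun f hf g hg => dx_add (S.smooth_B f hf) (S.smooth_B g hg))
        (fun c f hf => dx_smul c (S.smooth_B f hf)) hΔB,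
      map_dx_constMat, zero_add, map_dx_bdtDelta_inv hφ hψ hΔ hΔB,
      ← neg_one_smul ℂ (1 : Matrix (Fin K) (Fin K) ℂ), constMat_smul, constMat_one,
      Matrix.mul_smul, Matrix.mul_one, neg_one_smul, neg_neg]

lemma bdtW_act (hΔ : IsUnit (bdtDelta S C φ ψ)) :
    (bdtW S C φ ψ).act S φ = φ * (bdtDelta S C φ ψ)⁻¹ * constMat C := by
  simp only [bdtW, IDOp.sub, IDOp.one, IDOp.act]
  rw [map_antider_eq_sub (C := C), Matrix.mul_sub, Matrix.mul_assoc φ, bdtDelta_inv_mul hΔ,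
    neg_one_smul, Matrix.one_mul, Matrix.mul_one]
  abel

lemma bdtWinv_act (hC : IsUnit C) (hφ : EntriesIn S.P φ) (hψ : EntriesIn S.Q ψ)
    (hΔ : IsUnit (bdtDelta S C φ ψ)) (hΔB : EntriesIn S.B (bdtDelta S C φ ψ)⁻¹) :
    (bdtWinv S C φ ψ).act S (φ * (bdtDelta S C φ ψ)⁻¹) = φ * constMat C⁻¹ := by
  simp only [bdtWinv, IDOp.one, IDOp.act]
  have h := map_antider_inv hC hφ hψ hΔ hΔB
  simp only [Matrix.mul_assoc] at h ⊢
  rw [h, Matrix.mul_sub, Matrix.one_mul]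
  abel

/-- The transpose `W^{-1,τ} = I - ψ(Δ⁻¹)^⊤ D⁻¹ φ^⊤` has the shape of `W` with `φ` and `ψ` exchanged
and `Δ` transposed. -/
lemma bdtWinv_tr_act (hΔ : IsUnit (bdtDelta S C φ ψ)) :
    (bdtWinv S C φ ψ).tr.act S ψ =
      ψ * (bdtDelta S C φ ψ)⁻¹.transpose * constMat C.transpose := by
  have h : (φ.transpose * ψ).map (antider S) = (bdtDelta S C φ ψ - constMat C).transpose := by
    rw [← map_antider_eq_sub, ← Matrix.transpose_map, Matrix.transpose_mul,
      Matrix.transpose_transpose]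
  have h1 : (bdtDelta S C φ ψ)⁻¹.transpose * (bdtDelta S C φ ψ).transpose = 1 := by
    rw [← Matrix.transpose_mul, mul_eq_one_comm.mp (bdtDelta_inv_mul hΔ), Matrix.transpose_one]
  simp only [bdtWinv, IDOp.one, IDOp.tr, IDOp.act]
  rw [h, Matrix.transpose_mul, Matrix.transpose_transpose, Matrix.transpose_sub,
    Matrix.transpose_one, Matrix.one_mul, neg_one_smul, Matrix.mul_neg, Matrix.mul_sub,
    Matrix.mul_assoc ψ, h1, Matrix.mul_one, constMat_transpose]
  abel

/-- Here `W^τ = I + ψ D⁻¹ (φΔ⁻¹)^⊤`, and the integral that arises is the transpose of the one in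
`map_antider_inv`. -/
lemma bdtW_tr_act (hC : IsUnit C) (hφ : EntriesIn S.P φ) (hψ : EntriesIn S.Q ψ)
    (hΔ : IsUnit (bdtDelta S C φ ψ)) (hΔB : EntriesIn S.B (bdtDelta S C φ ψ)⁻¹) :
    (bdtW S C φ ψ).tr.act S (ψ * (bdtDelta S C φ ψ)⁻¹.transpose) =
      ψ * constMat C.transpose⁻¹ := by
  have h : ((φ * (bdtDelta S C φ ψ)⁻¹).transpose *
      (ψ * (bdtDelta S C φ ψ)⁻¹.transpose)).map (antider S) =
      (constMat C⁻¹ - (bdtDelta S C φ ψ)⁻¹).transpose := by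
    rw [← map_antider_inv hC hφ hψ hΔ hΔB, ← Matrix.transpose_map]
    simp only [Matrix.transpose_mul, Matrix.transpose_transpose, Matrix.mul_assoc]
  simp only [bdtW, IDOp.sub, IDOp.one, IDOp.tr, IDOp.act]
  rw [h, Matrix.transpose_transpose, Matrix.transpose_sub, Matrix.transpose_one, Matrix.one_mul,
    neg_one_smul, neg_one_smul, Matrix.mul_neg, neg_neg, Matrix.mul_sub,
    ← Matrix.transpose_nonsing_inv, constMat_transpose]
  abel

end FunctionSpaces

/-! ### The dressed linear problems. -/

theorem corollary4 {N m K : ℕ} (S : FunctionSpaces) (k l n : ℕ) (α c : ℂ)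
    -- the coefficients of the operators
    (J J' : Matrix (Fin N) (Fin N) ℂ)
    (u v : ℕ → Matrix (Fin N) (Fin N) Fn)
    (hu : ∀ j < k, EntriesIn S.B (u j)) (hv : ∀ i < n, EntriesIn S.B (v i))
    (M₀ : Matrix (Fin m) (Fin m) ℂ) (q r : Matrix (Fin N) (Fin m) Fn)
    (hq : EntriesIn S.P q) (hr : EntriesIn S.Q r)
    -- the operators
    (M L Ltilde : IDOp N N) (hM : M = IDOp.opM n α J' v M₀ q r)
    (hL : L = IDOp.opL S k l c J u M M₀ q r) (hLtilde : Ltilde = IDOp.opLtilde l c L M)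
    -- the data of the transformation
    (C Lam Lam' : Matrix (Fin K) (Fin K) ℂ) (hC : IsUnit C)
    (φ ψ : Matrix (Fin N) (Fin K) Fn)
    (hφ : EntriesIn S.P φ) (hψ : EntriesIn S.Q ψ)
    (hΔ : IsUnit (bdtDelta S C φ ψ)) (hΔB : EntriesIn S.B (bdtDelta S C φ ψ)⁻¹)
    -- the linear problems
    (hMφ : M.act S φ = φ * constMat Lam) (hMψ : M.tr.act S ψ = ψ * constMat Lam')
    (hLφ : L.act S φ = -c • (φ * constMat (Lam ^ (l + 1))))
    (hLψ : L.tr.act S ψ = -c • (ψ * constMat (Lam' ^ (l + 1))))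
    -- the dressed operators and the transformed functions
    (Mhat Lhat Ltildehat W Winv : IDOp N N) (hW : W = bdtW S C φ ψ) (hWinv : Winv = bdtWinv S C φ ψ)
    (hMhat : Mhat = dressed S C φ ψ M) (hLhat : Lhat = dressed S C φ ψ L)
    (hLtildehat : Ltildehat = dressed S C φ ψ Ltilde)
    (Φ Ψ : Matrix (Fin N) (Fin K) Fn)
    (hΦ : Φ = W.act S φ * constMat C⁻¹) (hΨ : Ψ = Winv.tr.act S ψ * constMat C.transpose⁻¹) :
    (Φ = φ * (bdtDelta S C φ ψ)⁻¹ ∧ Ψ = ψ * (bdtDelta S C φ ψ)⁻¹.transpose) ∧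
    (Ltildehat.act S Φ = Lhat.act S Φ + c • (Mhat.pow (l + 1)).act S Φ ∧
      Lhat.act S Φ + c • (Mhat.pow (l + 1)).act S Φ = 0) ∧
    (Ltildehat.tr.act S Ψ = Lhat.tr.act S Ψ + c • (Mhat.tr.pow (l + 1)).act S Ψ ∧
      Lhat.tr.act S Ψ + c • (Mhat.tr.pow (l + 1)).act S Ψ = 0) := by
  have hMP : M.IsConstLinear S S.P S.P := hM ▸ .opM hv hq hr
  have hMQ : M.tr.IsConstLinear S S.Q S.Q := hM ▸ .tr_opM hv hq hr
  have hLP : L.IsConstLinear S S.P S.P := hL ▸ .opL hu hMP hMQ hq hr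
  have hLQ : L.tr.IsConstLinear S S.Q S.Q := hL ▸ .tr_opL hu hMP hMQ hq hr
  have hΦ' : Φ = φ * (bdtDelta S C φ ψ)⁻¹ := by
    rw [hΦ, hW, FunctionSpaces.bdtW_act hΔ, Matrix.mul_assoc, constMat_mul_inv hC, Matrix.mul_one]
  have hCt : IsUnit C.transpose := (Matrix.isUnit_transpose C).mpr hC
  have hΨ' : Ψ = ψ * (bdtDelta S C φ ψ)⁻¹.transpose := by
    rw [hΨ, hWinv, FunctionSpaces.bdtWinv_tr_act hΔ, Matrix.mul_assoc, constMat_mul_inv hCt,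
      Matrix.mul_one]
  have hCC : C * C⁻¹ = 1 := Matrix.mul_nonsing_inv _ ((Matrix.isUnit_iff_isUnit_det _).mp hC)
  have hCCt : C.transpose * C.transpose⁻¹ = 1 :=
    Matrix.mul_nonsing_inv _ ((Matrix.isUnit_iff_isUnit_det _).mp hCt)
  obtain ⟨h1, h2⟩ := IDOp.conj_act (.bdtW hφ hψ hΔB) hMP hLP (.bdtWinv hφ hψ hΔB) hφ hCC
    (FunctionSpaces.bdtW_act hΔ) (FunctionSpaces.bdtWinv_act hC hφ hψ hΔ hΔB) hMφ hLφ
  -- Dual case: `W^{-1,τ}` dresses from the left and `W^τ` from the right, over `Q`.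
  obtain ⟨h3, h4⟩ := IDOp.conj_act (.tr_bdtWinv hφ hψ hΔB) hMQ hLQ (.tr_bdtW hφ hψ hΔB) hψ hCCt
    (FunctionSpaces.bdtWinv_tr_act hΔ) (FunctionSpaces.bdtW_tr_act hC hφ hψ hΔ hΔB) hMψ hLψ
  have hhat : Mhat.tr = ((bdtWinv S C φ ψ).tr.comp M.tr).comp (bdtW S C φ ψ).tr := by
    rw [hMhat]; rfl
  -- Transposing the triple product changes its bracketing, which alters the formal expression but
  -- not the action.
  have hassoc : ∀ j, (Mhat.tr.pow j).act S Ψ =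
      (((bdtWinv S C φ ψ).tr.comp (M.tr.comp (bdtW S C φ ψ).tr)).pow j).act S Ψ := by
    intro j
    rw [hhat]
    induction j with
    | zero => rfl
    | succ j ih => simp only [IDOp.pow, IDOp.act, ih]
  have hzero : Lhat.act S Φ + c • (Mhat.pow (l + 1)).act S Φ = 0 := by
    rw [hLhat, hMhat, hΦ']; exact h2
  have hzero' : Lhat.tr.act S Ψ + c • (Mhat.tr.pow (l + 1)).act S Ψ = 0 := by
    rw [hassoc, hLhat, hΨ']; exact h4
  refine ⟨⟨hΦ', hΨ'⟩, ⟨?_, hzero⟩, ?_, hzero'⟩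
  -- Both sides vanish, so `W` need not be distributed over the sum.
  · rw [hzero, hLtildehat, hLtilde, hΦ']
    exact h1
  · rw [hzero', hLtildehat, hLtilde, hΨ']
    -- The transpose of `L̃` contains `(M^{l+1})^τ`, whereas `h3` is about `(M^τ)^{l+1}`.
    rw [← IDOp.act_tr_pow] at h3
    exact h3
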